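/- Let $G=(V,E)$ be a finite, undirected, loopless, connected multigraph with $|V|\ge 2$, and let $$\mathrm{Rel}(G;q)=\sum_{A}(1-q)^{|A|}q^{|E|-|A|}$$ be its all-terminal reliability polynomial, where the sum is over all $A\subseteq E$ for which the spanning subgraph $(V,A)$ is connected. A block of $G$ is a maximal connected subgraph of $G$ that has no cut vertex of its own, and the order of a graph is its number of vertices. Let $s$ be the maximum order of a block of $G$. Then every complex root $z$ of $\mathrm{Rel}(G;q)$ satisfies $|z|\le s-1$. Further, if $s\ge 3$ and every block $B$ of $G$ of order $s$ has a vertex $w$ with no incident multiple edges in $B$ (that is, no two distinct edges of $B$ incident with $w$ have the same two ends), then every complex root $z$ of $\mathrm{Rel}(G;q)$ satisfies $|z|\le s-2$; in particular this holds if $s\ge 3$ and $G$ is a simple graph. -/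

import Mathlib

namespace Graph

/-- Two vertices of the multigraph `G` can communicate: they are vertices of `G` joined by a
(possibly trivial) walk in `G`. -/
def Reachable {α β : Type*} (G : Graph α β) (x y : α) : Prop :=
  x ∈ G.vertexSet ∧ y ∈ G.vertexSet ∧ Relation.ReflTransGen G.Adj x y

/-- A multigraph is connected if it has a vertex and any two of its vertices are joined by a
walk. -/
def Connected {α β : Type*} (G : Graph α β) : Prop :=
  G.vertexSet.Nonempty ∧ ∀ x ∈ G.vertexSet, ∀ y ∈ G.vertexSet, G.Reachable x y

/-- A cut vertex of `G`: a vertex `x` whose deletion separates two vertices `u, v ≠ x` that are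
joined by a walk in `G`. -/
def IsCutVertex {α β : Type*} (G : Graph α β) (x : α) : Prop :=
  x ∈ G.vertexSet ∧
    ∃ u v, u ≠ x ∧ v ≠ x ∧ G.Reachable u v ∧ ¬ (G.deleteVerts {x}).Reachable u v

/-- A block of `G`: a maximal subgraph of `G` that is connected and has no cut vertex
of its own. -/
def IsBlock {α β : Type*} (G B : Graph α β) : Prop :=
  Maximal (fun H : Graph α β => H ≤ G ∧ H.Connected ∧ ∀ x, ¬ H.IsCutVertex x) B

/-- In `G` the vertex `w` has no incident multiple edges: no two distinct edges at `w` have the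
same ends. -/
def NoMultipleEdgesAt {α β : Type*} (G : Graph α β) (w : α) : Prop :=
  ∀ e f x, G.IsLink e w x → G.IsLink f w x → e = f

open Classical in
/-- The all-terminal reliability polynomial of a multigraph `G` with finite edge set, in the
variable `q` (the failure probability of an edge): the sum over all sets `A` of operational edges
for which the spanning subgraph with edge set `A` is connected of
`(1 - q) ^ |A| * q ^ |E \ A|`. -/
noncomputable def reliability {α β : Type*} (G : Graph α β) (hE : G.edgeSet.Finite) :
    Polynomial ℤ :=
  ∑ A ∈ hE.toFinset.powerset.filter (fun A : Finset β => (G.restrict (↑A : Set β)).Connected),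
    (1 - Polynomial.X) ^ A.card * Polynomial.X ^ (hE.toFinset \ A).card

end Graph

/-! Fix a root `r` in a vertex set `S` inducing a connected subgraph. The reliability of `S` at `q`
equals `(1 - q) ^ (|S| - 1) * ∑ q ^ deg c` over the parking functions `c` on `S`
(`relSum_eq_parkSum`, `parkSum_eq`). Both sides, call them `X S`, satisfy `∑ X T * q ^ e(T, S \ T) =
1`, summed over `T ⊆ S` containing `r`, and this determines `X` by induction on `S`. For
reliability, condition on the component of `r` (`sum_relSum`). For parking functions, give each
vertex an independent geometric variable and condition on the set burnt from `r` (`sum_parkSum`).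

Parking functions are closed downwards, and each lies below one of the top degree
(`exists_le_parking_degree`). Hence below the top degree each arises by lowering one support
coordinate of a parking function one degree higher. If supports have at most `K` elements, the
numbers `h i` of parking functions of degree `i` satisfy `h i ≤ K * h (i + 1)`, and Eneström–Kakeya
puts the roots in `‖z‖ ≤ K`. Supports avoid `r`, so `K = |S| - 1` works. If `r` has no multiple
edges, the first vertex burnt has value `0`, so `K = |S| - 2` works.

Reliability is multiplicative over cut vertices (`IsSplit.relSum_union`), so every root already
occurs for a vertex set inducing a connected subgraph without cut vertices. Such a subgraph lies in
a block. -/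

namespace Graph

open Finset
open scoped Classical

/-! ### Factorisation of finite sums -/

section FinsetSums

/-- A sum over the subsets of a disjoint union factors. -/
lemma sum_powerset_union_mul {ι R : Type*} [CommSemiring R] {s t : Finset ι} (h : Disjoint s t)
    (f g : Finset ι → R) :
    ∑ A ∈ (s ∪ t).powerset, f (A ∩ s) * g (A ∩ t) =
      (∑ A ∈ s.powerset, f A) * ∑ A ∈ t.powerset, g A := by
  rw [sum_mul_sum, ← sum_product']
  refine sum_nbij' (fun A => (A ∩ s, A ∩ t)) (fun p => p.1 ∪ p.2) ?_ ?_ ?_ ?_ ?_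
  · intro A _
    simp
  · rintro ⟨A, B⟩ hp
    simp only [mem_product, mem_powerset] at hp ⊢
    exact union_subset_union hp.1 hp.2
  · intro A hA
    rw [mem_powerset] at hA
    simp only
    rw [← inter_union_distrib_left, inter_eq_left.2 hA]
  · rintro ⟨A, B⟩ hp
    simp only [mem_product, mem_powerset] at hp
    have h1 : B ∩ s = ∅ := (h.symm.mono_left hp.2).eq_bot
    have h2 : A ∩ t = ∅ := (h.mono_left hp.1).eq_bot
    simp only [union_inter_distrib_right, h1, h2, inter_eq_left.2 hp.1, inter_eq_left.2 hp.2,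
      union_empty, empty_union]
  · intro A _
    rfl

/-- Product of sums as a sum over finitely supported choice functions. -/
lemma sum_finsupp_prod {ι R : Type*} [CommSemiring R] (s : Finset ι) (t : Finset ℕ)
    (g : ι → ℕ → R) :
    ∑ c ∈ s.finsupp (fun _ => t), ∏ v ∈ s, g v (c v) = ∏ v ∈ s, ∑ k ∈ t, g v k := by
  rw [prod_sum, Finset.finsupp, sum_map]
  refine sum_congr (by congr) fun p _ => ?_
  rw [← prod_attach]
  refine prod_congr rfl fun x _ => ?_
  simp [Finsupp.indicator_apply]

/-- A sum over finitely supported functions on a disjoint union factors. -/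
lemma sum_finsupp_union_mul {ι R : Type*} [CommSemiring R] {s u : Finset ι} (h : Disjoint s u)
    {t : Finset ℕ} (f : (ι →₀ ℕ) → R) (g : ι → ℕ → R) :
    ∑ c ∈ (s ∪ u).finsupp (fun _ => t), f (c.filter (· ∈ s)) * ∏ v ∈ u, g v (c v) =
      (∑ c ∈ s.finsupp (fun _ => t), f c) * ∏ v ∈ u, ∑ k ∈ t, g v k := by
  rw [← sum_finsupp_prod, sum_mul_sum, ← sum_product']
  rw [disjoint_left] at h
  refine sum_nbij' (fun c => (c.filter (· ∈ s), c.filter (· ∈ u))) (fun p => p.1 + p.2)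
    ?_ ?_ ?_ ?_ ?_
  · intro c hc
    simp only [mem_product, mem_finsupp_iff, mem_union] at hc ⊢
    refine ⟨⟨fun v hv => ?_, fun v hv => ?_⟩, ⟨fun v hv => ?_, fun v hv => ?_⟩⟩
    · simp only [Finsupp.support_filter, mem_filter] at hv
      exact hv.2
    · simpa [hv] using hc.2 v (Or.inl hv)
    · simp only [Finsupp.support_filter, mem_filter] at hv
      exact hv.2
    · simpa [hv] using hc.2 v (Or.inr hv)
  · rintro ⟨a, b⟩ hp
    simp only [mem_product, mem_finsupp_iff, mem_union] at hp ⊢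
    obtain ⟨⟨ha, ha'⟩, hb, hb'⟩ := hp
    refine ⟨Finsupp.support_add.trans (union_subset_union ha hb), fun v hv => ?_⟩
    rcases hv with hv | hv
    · have : b v = 0 := Finsupp.notMem_support_iff.1 fun h' => h hv (hb h')
      simpa [this] using ha' v hv
    · have : a v = 0 := Finsupp.notMem_support_iff.1 fun h' => h (ha h') hv
      simpa [this] using hb' v hv
  · intro c hc
    simp only [mem_finsupp_iff] at hc
    ext v
    simp only [Finsupp.add_apply, Finsupp.filter_apply]
    by_cases h1 : v ∈ s
    · simp [h1, h h1]
    · by_cases h2 : v ∈ u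
      · simp [h1, h2]
      · have : c v = 0 := Finsupp.notMem_support_iff.1 fun h' => by
          simpa [h1, h2] using hc.1 h'
        simp [h1, h2, this]
  · rintro ⟨a, b⟩ hp
    simp only [mem_product, mem_finsupp_iff] at hp
    obtain ⟨⟨ha, -⟩, hb, -⟩ := hp
    have hb0 : ∀ v ∉ u, b v = 0 := fun v hv => Finsupp.notMem_support_iff.1 fun h' => hv (hb h')
    have ha0 : ∀ v ∉ s, a v = 0 := fun v hv => Finsupp.notMem_support_iff.1 fun h' => hv (ha h')
    refine Prod.ext ?_ ?_ <;> ext v <;> simp only [Finsupp.add_apply, Finsupp.filter_apply]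
    · by_cases h1 : v ∈ s
      · simp [h1, hb0 v (h h1)]
      · simp [h1, ha0 v h1]
    · by_cases h1 : v ∈ u
      · simp [h1, ha0 v fun h' => h h' h1]
      · simp [h1, hb0 v h1]
  · intro c _
    simp only
    congr 1
    refine prod_congr rfl fun v hv => ?_
    simp [hv]

/-- A sum of a term selected by a uniquely satisfied condition. -/
lemma sum_ite_of_existsUnique {ι R : Type*} [AddCommMonoid R] {s : Finset ι} {p : ι → Prop}
    [DecidablePred p] (h : ∃! i, i ∈ s ∧ p i) (a : R) : ∑ i ∈ s, (if p i then a else 0) = a := by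
  obtain ⟨i, ⟨hi, hp⟩, hu⟩ := h
  rw [sum_eq_single_of_mem i hi fun j hj hne => if_neg fun hpj => hne (hu j ⟨hj, hpj⟩), if_pos hp]

end FinsetSums

/-! ### Abstract spreading from a root, common to connectivity and burning -/

section Spreading

variable {α : Type*}

/-- With `D v W` read as "`v` is reached from `W`", the whole of `T` is reached from `r`: every
nonempty set of vertices of `T` avoiding `r` has a vertex reached from the rest of `T`. -/
def Spans (D : α → Finset α → Prop) (r : α) (T : Finset α) : Prop :=
  ∀ U ⊆ T, U.Nonempty → r ∉ U → ∃ v ∈ U, D v (T \ U)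

lemma spans_singleton (D : α → Finset α → Prop) (r : α) : Spans D r {r} := by
  intro U hU hne hr
  obtain ⟨v, hv⟩ := hne
  rw [mem_singleton.1 (hU hv)] at hv
  exact (hr hv).elim

lemma Spans.mono_rel {D D' : α → Finset α → Prop} {r : α} {T : Finset α}
    (h : Spans D r T) (hD : ∀ v ∈ T, v ≠ r → ∀ W ⊆ T, D v W → D' v W) : Spans D' r T := by
  intro U hU hne hr
  obtain ⟨v, hv, hvD⟩ := h U hU hne hr
  exact ⟨v, hv, hD v (hU hv) (fun h => hr (h ▸ hv)) _ sdiff_subset hvD⟩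

lemma Spans.insert {D : α → Finset α → Prop} (hD : ∀ v, Monotone (D v)) {r v : α} {T : Finset α}
    (h : Spans D r T) (hv : D v T) : Spans D r (insert v T) := by
  intro U hU hne hr
  by_cases hUT : (U ∩ T).Nonempty
  · obtain ⟨u, hu, huD⟩ := h (U ∩ T) inter_subset_right hUT (fun h => hr (mem_inter.1 h).1)
    refine ⟨u, (mem_inter.1 hu).1, hD u ?_ huD⟩
    intro x hx
    simp only [mem_sdiff, mem_inter, mem_insert] at hx ⊢
    tauto
  · rw [not_nonempty_iff_eq_empty] at hUT
    have hUv : ∀ x ∈ U, x = v := fun x hx => by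
      rcases mem_insert.1 (hU hx) with h | h
      · exact h
      · exact absurd (mem_inter.2 ⟨hx, h⟩) (by simp [hUT])
    obtain ⟨u, hu⟩ := hne
    obtain rfl := hUv u hu
    refine ⟨u, hu, hD u ?_ hv⟩
    intro x hx
    have : x ∉ U := fun h => absurd (mem_inter.2 ⟨h, hx⟩) (by simp [hUT])
    simp [hx, this]

/-- The set of vertices of `S` reached from `r` is characterised by spreading inside and
being closed. -/
lemma existsUnique_spans {D : α → Finset α → Prop} (hD : ∀ v, Monotone (D v)) {r : α}
    {S : Finset α} (hr : r ∈ S) :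
    ∃! T, T ∈ S.powerset.filter (r ∈ ·) ∧ (Spans D r T ∧ ∀ v ∈ S \ T, ¬ D v T) := by
  -- A spanned set cannot leave a closed one: spreading into `T' \ T` would contradict closedness of
  -- `T`.
  have hle : ∀ T T' : Finset α, r ∈ T → T' ⊆ S → Spans D r T' → (∀ v ∈ S \ T, ¬ D v T) →
      T' ⊆ T := by
    intro T T' hrT hT' hsp hcl
    by_contra hne
    obtain ⟨v, hv, hvD⟩ := hsp (T' \ T) sdiff_subset (sdiff_nonempty.2 hne) (by simp [hrT])
    rw [mem_sdiff] at hv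
    refine hcl v (mem_sdiff.2 ⟨hT' hv.1, hv.2⟩) (hD v ?_ hvD)
    intro x hx
    simp only [mem_sdiff] at hx
    tauto
  obtain ⟨T, hT, hmax⟩ := ((S.powerset.filter fun T => r ∈ T ∧ Spans D r T)).exists_max_image
    Finset.card ⟨{r}, by simp [hr, spans_singleton]⟩
  simp only [mem_filter, mem_powerset] at hT hmax
  obtain ⟨hTS, hrT, hsp⟩ := hT
  have hcl : ∀ v ∈ S \ T, ¬ D v T := by
    intro v hv hvD
    rw [mem_sdiff] at hv
    have := hmax (insert v T) ⟨insert_subset hv.1 hTS, mem_insert_of_mem hrT, hsp.insert hD hvD⟩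
    rw [card_insert_of_notMem hv.2] at this
    omega
  refine ⟨T, ⟨by simp [hTS, hrT], hsp, hcl⟩, ?_⟩
  rintro T' ⟨hT', hsp', hcl'⟩
  simp only [mem_filter, mem_powerset] at hT'
  exact (hle T T' hrT hT'.1 hsp' hcl).antisymm (hle T' T hT'.2 hTS hsp hcl')

end Spreading

/-! ### The Eneström–Kakeya bound -/

section EnestromKakeya

/-- Eneström–Kakeya: a polynomial with nonnegative coefficients, the last one positive, and with
`h i ≤ K * h (i + 1)`, has all its roots in the disc of radius `K`. -/
lemma norm_le_of_sum_eq_zero {h : ℕ → ℝ} {g : ℕ} {K : ℝ} (hK : 0 ≤ K)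
    (hpos : 0 < h g) (hnn : ∀ i, 0 ≤ h i) (hstep : ∀ i < g, h i ≤ K * h (i + 1)) {z : ℂ}
    (hz : ∑ i ∈ range (g + 1), (h i : ℂ) * z ^ i = 0) : ‖z‖ ≤ K := by
  by_contra! hlt
  -- Used over `ℂ` at `z` and over `ℝ` at `‖z‖`: every coefficient in the subtracted bracket is
  -- nonnegative, so the triangle inequality compares the two.
  have hid : ∀ {F : Type} [Field F] (a : ℕ → F) (k x : F),
      (x - k) * ∑ i ∈ range (g + 1), a i * x ^ i =
        a g * x ^ (g + 1) - (k * a 0 + ∑ i ∈ range g, (k * a (i + 1) - a i) * x ^ (i + 1)) := by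
    intro F _ a k x
    have h1 : k * ∑ i ∈ range (g + 1), a i * x ^ i =
        k * a 0 + ∑ i ∈ range g, k * a (i + 1) * x ^ (i + 1) := by
      rw [sum_range_succ', mul_add, mul_sum, add_comm]
      simp [mul_assoc]
    have h2 : x * ∑ i ∈ range (g + 1), a i * x ^ i =
        ∑ i ∈ range g, a i * x ^ (i + 1) + a g * x ^ (g + 1) := by
      rw [mul_sum, sum_range_succ]
      congr 1
      · exact sum_congr rfl fun i _ => by ring
      · ring
    rw [sub_mul, h1, h2]
    simp only [sub_mul, sum_sub_distrib]
    ring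
  have hc := hid (fun i => (h i : ℂ)) (K : ℂ) z
  rw [hz, mul_zero] at hc
  have hr := hid h K ‖z‖
  have hle : h g * ‖z‖ ^ (g + 1) ≤
      K * h 0 + ∑ i ∈ range g, (K * h (i + 1) - h i) * ‖z‖ ^ (i + 1) := by
    have heq : (h g : ℂ) * z ^ (g + 1) = K * h 0 +
        ∑ i ∈ range g, ((K * h (i + 1) - h i : ℝ) : ℂ) * z ^ (i + 1) := by
      rw [eq_comm, sub_eq_zero] at hc
      simpa using hc
    have hn := congrArg norm heq
    rw [norm_mul, norm_pow, Complex.norm_real, Real.norm_of_nonneg hpos.le] at hn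
    rw [hn]
    refine (norm_add_le _ _).trans (add_le_add ?_ ((norm_sum_le _ _).trans (sum_le_sum ?_)))
    · rw [norm_mul, Complex.norm_real, Complex.norm_real, Real.norm_of_nonneg hK,
        Real.norm_of_nonneg (hnn 0)]
    · intro i hi
      rw [norm_mul, norm_pow, Complex.norm_real,
        Real.norm_of_nonneg (sub_nonneg.2 (hstep i (mem_range.1 hi)))]
  have hp : 0 < ∑ i ∈ range (g + 1), h i * ‖z‖ ^ i := by
    refine sum_pos' (fun i _ => mul_nonneg (hnn i) (by positivity)) ⟨g, by simp, ?_⟩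
    exact mul_pos hpos (pow_pos (hK.trans_lt hlt) _)
  have := mul_pos (sub_pos.2 hlt) hp
  linarith

end EnestromKakeya

/-! ### One recursion for reliability and for parking functions -/

section Recursion

variable {α β : Type*} {G : Graph α β} (hE : G.edgeSet.Finite) {R : Type*} [CommRing R]

/-- The edges of `G` with all ends in `S`. -/
noncomputable def edgesIn (S : Finset α) : Finset β :=
  hE.toFinset.filter fun e => ∀ v, G.Inc e v → v ∈ S

/-- The edges of `G` from `v` to a vertex of `W`. -/
noncomputable def edgesTo (v : α) (W : Finset α) : Finset β :=
  hE.toFinset.filter fun e => ∃ w ∈ W, G.IsLink e v w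

/-- The edges of `G` between `T` and the rest of `S`. -/
noncomputable def edgesBetween (T S : Finset α) : Finset β :=
  (S \ T).biUnion fun v => edgesTo hE v T

lemma mem_edgesTo {v : α} {W : Finset α} {e : β} :
    e ∈ edgesTo hE v W ↔ ∃ w ∈ W, G.IsLink e v w := by
  simp only [edgesTo, mem_filter, Set.Finite.mem_toFinset, and_iff_right_iff_imp]
  rintro ⟨w, -, h⟩
  exact h.edge_mem

lemma mem_edgesIn {S : Finset α} {e : β} :
    e ∈ edgesIn hE S ↔ ∃ x ∈ S, ∃ y ∈ S, G.IsLink e x y := by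
  simp only [edgesIn, mem_filter, Set.Finite.mem_toFinset]
  constructor
  · rintro ⟨he, h⟩
    obtain ⟨x, y, hxy⟩ := exists_isLink_of_mem_edgeSet he
    exact ⟨x, h x hxy.inc_left, y, h y hxy.inc_right, hxy⟩
  · rintro ⟨x, hx, y, hy, hxy⟩
    refine ⟨hxy.edge_mem, fun v hv => ?_⟩
    rcases hv.eq_or_eq_of_isLink hxy with rfl | rfl <;> assumption

lemma mem_edgesIn_of_isLink {S : Finset α} {e : β} {x y : α} (h : G.IsLink e x y) :
    e ∈ edgesIn hE S ↔ x ∈ S ∧ y ∈ S := by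
  rw [mem_edgesIn]
  constructor
  · rintro ⟨a, ha, b, hb, hab⟩
    rcases hab.eq_and_eq_or_eq_and_eq h with ⟨rfl, rfl⟩ | ⟨rfl, rfl⟩ <;>
      exact ⟨by assumption, by assumption⟩
  · rintro ⟨hx, hy⟩
    exact ⟨x, hx, y, hy, h⟩

lemma edgesTo_mono (v : α) : Monotone (edgesTo hE v) := by
  intro W W' h e he
  rw [mem_edgesTo] at he ⊢
  obtain ⟨w, hw, hl⟩ := he
  exact ⟨w, h hw, hl⟩

lemma mem_edgesBetween {T S : Finset α} {e : β} :
    e ∈ edgesBetween hE T S ↔ ∃ v ∈ S \ T, ∃ w ∈ T, G.IsLink e v w := by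
  simp only [edgesBetween, mem_biUnion, mem_edgesTo]

lemma card_edgesBetween (T S : Finset α) :
    (edgesBetween hE T S).card = ∑ v ∈ S \ T, (edgesTo hE v T).card := by
  refine card_biUnion fun v hv u hu hne => disjoint_left.2 fun e h1 h2 => ?_
  rw [mem_edgesTo] at h1 h2
  obtain ⟨w, hw, h⟩ := h1
  obtain ⟨w', hw', h'⟩ := h2
  rcases h.left_eq_or_eq h' with h3 | h3
  · exact hne h3
  · exact (mem_sdiff.1 (mem_coe.1 hv)).2 (h3 ▸ hw')

lemma edgesIn_eq_union {T S : Finset α} (hTS : T ⊆ S) :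
    edgesIn hE S = edgesIn hE T ∪ (edgesBetween hE T S ∪ edgesIn hE (S \ T)) := by
  ext e
  simp only [mem_union, mem_edgesBetween]
  constructor
  · intro h
    obtain ⟨x, hx, y, hy, hl⟩ := (mem_edgesIn hE).1 h
    rw [mem_edgesIn_of_isLink hE hl, mem_edgesIn_of_isLink hE hl]
    simp only [mem_sdiff]
    by_cases hxT : x ∈ T <;> by_cases hyT : y ∈ T
    · exact Or.inl ⟨hxT, hyT⟩
    · exact Or.inr (Or.inl ⟨y, ⟨hy, hyT⟩, x, hxT, hl.symm⟩)
    · exact Or.inr (Or.inl ⟨x, ⟨hx, hxT⟩, y, hyT, hl⟩)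
    · exact Or.inr (Or.inr ⟨⟨hx, hxT⟩, hy, hyT⟩)
  · rintro (h | ⟨v, hv, w, hw, hl⟩ | h)
    · obtain ⟨x, hx, y, hy, hl⟩ := (mem_edgesIn hE).1 h
      exact (mem_edgesIn hE).2 ⟨x, hTS hx, y, hTS hy, hl⟩
    · exact (mem_edgesIn hE).2 ⟨v, (mem_sdiff.1 hv).1, w, hTS hw, hl⟩
    · obtain ⟨x, hx, y, hy, hl⟩ := (mem_edgesIn hE).1 h
      exact (mem_edgesIn hE).2 ⟨x, (mem_sdiff.1 hx).1, y, (mem_sdiff.1 hy).1, hl⟩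

lemma disjoint_edgesBetween_edgesIn (T S : Finset α) :
    Disjoint (edgesBetween hE T S) (edgesIn hE (S \ T)) := by
  refine disjoint_left.2 fun e h1 h2 => ?_
  obtain ⟨v, hv, w, hw, hl⟩ := (mem_edgesBetween hE).1 h1
  exact (mem_sdiff.1 ((mem_edgesIn_of_isLink hE hl).1 h2).2).2 hw

lemma disjoint_edgesIn_union (T S : Finset α) :
    Disjoint (edgesIn hE T) (edgesBetween hE T S ∪ edgesIn hE (S \ T)) := by
  refine disjoint_left.2 fun e h1 h2 => ?_
  rcases mem_union.1 h2 with h2 | h2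
  · obtain ⟨v, hv, w, hw, hl⟩ := (mem_edgesBetween hE).1 h2
    exact (mem_sdiff.1 hv).2 ((mem_edgesIn_of_isLink hE hl).1 h1).1
  · obtain ⟨x, hx, y, hy, hl⟩ := (mem_edgesIn hE).1 h1
    exact (mem_sdiff.1 ((mem_edgesIn_of_isLink hE hl).1 h2).1).2 hx

/-- `v` is joined to a vertex of `W` by an edge of `A`. -/
def LinkedTo (G : Graph α β) (A : Finset β) (v : α) (W : Finset α) : Prop :=
  ∃ e ∈ A, ∃ w ∈ W, G.IsLink e v w

lemma linkedTo_monotone (A : Finset β) (v : α) : Monotone (LinkedTo G A v) := by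
  rintro W W' h ⟨e, he, w, hw, hl⟩
  exact ⟨e, he, w, h hw, hl⟩

lemma spans_linkedTo_congr {A B : Finset β} {r : α} {T : Finset α}
    (h : A ∩ edgesIn hE T = B ∩ edgesIn hE T) :
    Spans (LinkedTo G A) r T ↔ Spans (LinkedTo G B) r T := by
  have key : ∀ A B : Finset β, A ∩ edgesIn hE T = B ∩ edgesIn hE T →
      Spans (LinkedTo G A) r T → Spans (LinkedTo G B) r T := by
    intro A B h hA
    refine hA.mono_rel ?_
    rintro v hv - W hW ⟨e, he, w, hw, hl⟩
    refine ⟨e, ?_, w, hw, hl⟩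
    have : e ∈ A ∩ edgesIn hE T :=
      mem_inter.2 ⟨he, (mem_edgesIn_of_isLink hE hl).2 ⟨hv, hW hw⟩⟩
    rw [h] at this
    exact (mem_inter.1 this).1
  exact ⟨key A B h, key B A h.symm⟩

/-- The weight of the state in which `A` is the set of operational edges among `F`. -/
noncomputable def stateWeight (q : R) (F A : Finset β) : R :=
  (1 - q) ^ A.card * q ^ (F \ A).card

lemma sum_stateWeight (q : R) (F : Finset β) : ∑ A ∈ F.powerset, stateWeight q F A = 1 := by
  have h := sum_pow_mul_eq_add_pow (1 - q) q F
  rw [sub_add_cancel, one_pow] at h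
  rw [← h]
  refine sum_congr rfl fun A hA => ?_
  rw [stateWeight, card_sdiff_of_subset (mem_powerset.1 hA)]

lemma stateWeight_union {q : R} {F F' A : Finset β} (hF : Disjoint F F') (hA : A ⊆ F ∪ F') :
    stateWeight q (F ∪ F') A = stateWeight q F (A ∩ F) * stateWeight q F' (A ∩ F') := by
  have h1 : A.card = (A ∩ F).card + (A ∩ F').card := by
    rw [← card_union_of_disjoint (hF.mono inter_subset_right inter_subset_right),
      ← inter_union_distrib_left, inter_eq_left.2 hA]
  have h2 : ((F ∪ F') \ A).card = (F \ (A ∩ F)).card + (F' \ (A ∩ F')).card := by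
    rw [← card_union_of_disjoint (hF.mono sdiff_subset sdiff_subset)]
    congr 1
    ext x
    simp only [mem_sdiff, mem_union, mem_inter]
    tauto
  rw [stateWeight, stateWeight, stateWeight, h1, h2, pow_add, pow_add]
  ring

/-- The reliability of the subgraph induced on `T`, evaluated at `q`. -/
noncomputable def relSum (q : R) (r : α) (T : Finset α) : R :=
  ∑ A ∈ (edgesIn hE T).powerset,
    if Spans (LinkedTo G A) r T then stateWeight q (edgesIn hE T) A else 0

/-- The component of `r` is `T` when the edges inside `T` connect it and all edges from `T` to `S \
T` fail, each contributing a factor `q`. Edges inside `S \ T` are free and contribute total weight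
`1`. -/
lemma sum_states_component {q : R} {r : α} {T S : Finset α} (hTS : T ⊆ S) :
    ∑ A ∈ (edgesIn hE S).powerset,
      (if Spans (LinkedTo G A) r T ∧ ∀ v ∈ S \ T, ¬ LinkedTo G A v T then
        stateWeight q (edgesIn hE S) A else 0) =
      relSum hE q r T * q ^ (edgesBetween hE T S).card := by
  set C := edgesBetween hE T S
  set F := edgesIn hE (S \ T)
  have hCF : Disjoint C F := disjoint_edgesBetween_edgesIn hE T S
  have hT : Disjoint (edgesIn hE T) (C ∪ F) := disjoint_edgesIn_union hE T S
  have hrest : ∑ A ∈ (C ∪ F).powerset, (if A ∩ C = ∅ then stateWeight q (C ∪ F) A else 0) =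
      q ^ C.card := by
    have := sum_powerset_union_mul hCF
      (fun A => if A = ∅ then stateWeight q C A else 0) (stateWeight q F)
    rw [sum_stateWeight, mul_one] at this
    rw [sum_eq_single_of_mem (∅ : Finset β) (by simp) fun A _ hA => if_neg hA] at this
    simp only [if_true] at this
    rw [show q ^ C.card = stateWeight q C ∅ by simp [stateWeight], ← this]
    refine sum_congr rfl fun A hA => ?_
    rw [stateWeight_union hCF (mem_powerset.1 hA)]
    split_ifs <;> simp
  rw [relSum, ← hrest, ← sum_powerset_union_mul hT, ← edgesIn_eq_union hE hTS]
  refine sum_congr rfl fun A hA => ?_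
  rw [mem_powerset, edgesIn_eq_union hE hTS] at hA
  have h1 : Spans (LinkedTo G (A ∩ edgesIn hE T)) r T ↔ Spans (LinkedTo G A) r T :=
    spans_linkedTo_congr hE (by rw [inter_assoc, inter_self])
  have h2 : A ∩ (C ∪ F) ∩ C = ∅ ↔ ∀ v ∈ S \ T, ¬ LinkedTo G A v T := by
    rw [inter_assoc, inter_eq_right.2 (subset_union_left : C ⊆ C ∪ F), eq_empty_iff_forall_notMem]
    constructor
    · rintro h v hv ⟨e, he, w, hw, hl⟩
      exact h e (mem_inter.2 ⟨he, (mem_edgesBetween hE).2 ⟨v, hv, w, hw, hl⟩⟩)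
    · intro h e he
      obtain ⟨v, hv, w, hw, hl⟩ := (mem_edgesBetween hE).1 (mem_inter.1 he).2
      exact h v hv ⟨e, (mem_inter.1 he).1, w, hw, hl⟩
  rw [edgesIn_eq_union hE hTS, stateWeight_union hT hA]
  simp only [h1, h2]
  by_cases h3 : Spans (LinkedTo G A) r T <;>
    by_cases h4 : ∀ v ∈ S \ T, ¬ LinkedTo G A v T
  · rw [if_pos h3, if_pos h4, if_pos ⟨h3, h4⟩]
  · rw [if_pos h3, if_neg h4, if_neg (fun h => h4 h.2), mul_zero]
  · rw [if_neg h3, if_neg (fun h => h3 h.1), zero_mul]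
  · rw [if_neg h3, if_neg (fun h => h3 h.1), zero_mul]

/-- Conditioning on the component of `r`. -/
lemma sum_relSum (q : R) {r : α} {S : Finset α} (hr : r ∈ S) :
    ∑ T ∈ S.powerset.filter (r ∈ ·), relSum hE q r T * q ^ (edgesBetween hE T S).card = 1 := by
  rw [← sum_stateWeight q (edgesIn hE S)]
  rw [sum_congr rfl fun T hT => (sum_states_component hE
    (mem_powerset.1 (mem_filter.1 hT).1)).symm, sum_comm]
  exact sum_congr rfl fun A _ => sum_ite_of_existsUnique
    (existsUnique_spans (linkedTo_monotone A) hr) _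

/-- `c v` is smaller than the number of edges from `v` to `W`. -/
def BurntBy (c : α →₀ ℕ) (v : α) (W : Finset α) : Prop :=
  c v < (edgesTo hE v W).card

lemma burntBy_monotone (c : α →₀ ℕ) (v : α) : Monotone (BurntBy hE c v) :=
  fun _ _ h hb => hb.trans_le (card_le_card (edgesTo_mono hE v h))

lemma Spans.burntBy_anti {c c' : α →₀ ℕ} {r : α} {T : Finset α}
    (h : Spans (BurntBy hE c) r T) (hc : ∀ v ∈ T, v ≠ r → c' v ≤ c v) :
    Spans (BurntBy hE c') r T :=
  h.mono_rel fun v hv hvr _ _ hb => (hc v hv hvr).trans_lt hb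

lemma card_edgesTo_le (v : α) (W : Finset α) :
    (edgesTo hE v W).card ≤ hE.toFinset.card := card_filter_le _ _

/-- The geometric distribution truncated at `N`. -/
def truncGeom (q : R) (N k : ℕ) : R := if k < N then (1 - q) * q ^ k else q ^ N

/-- The tail telescopes. The value `N` carries the whole remaining mass `q ^ N`, so the identity is
exact in any commutative ring and needs no convergence. -/
lemma sum_truncGeom (q : R) {N m : ℕ} (hm : m ≤ N) :
    ∑ k ∈ range (N + 1), (if m ≤ k then truncGeom q N k else 0) = q ^ m := by
  have key : ∀ n, ∑ k ∈ range n, (if m ≤ k then (1 - q) * q ^ k else 0) =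
      if m ≤ n then q ^ m - q ^ n else 0 := by
    intro n
    induction n with
    | zero =>
      rcases Nat.eq_zero_or_pos m with rfl | h
      · simp
      · simp [h.ne']
    | succ n ih =>
      rw [sum_range_succ, ih]
      rcases lt_trichotomy m (n + 1) with h | h | h
      · rw [if_pos (by omega), if_pos (by omega), if_pos (by omega)]
        ring
      · subst h
        simp
      · rw [if_neg (by omega), if_neg (by omega), if_neg (by omega), add_zero]
  have h : ∑ k ∈ range N, (if m ≤ k then truncGeom q N k else 0) =
      ∑ k ∈ range N, (if m ≤ k then (1 - q) * q ^ k else 0) :=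
    sum_congr rfl fun k hk => by rw [truncGeom, if_pos (mem_range.1 hk)]
  rw [sum_range_succ, h, key, if_pos hm, if_pos hm, truncGeom, if_neg (lt_irrefl N),
    sub_add_cancel]

/-- The functions on `S` with values at most the number of edges. -/
noncomputable def boundedFun (S : Finset α) : Finset (α →₀ ℕ) :=
  S.finsupp fun _ => range (hE.toFinset.card + 1)

/-- The parking functions on `T` with root `r`. -/
noncomputable def parking (r : α) (T : Finset α) : Finset (α →₀ ℕ) :=
  (boundedFun hE (T.erase r)).filter fun c => Spans (BurntBy hE c) r T

/-- The total weight of the parking functions on `T`. -/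
noncomputable def parkSum (q : R) (r : α) (T : Finset α) : R :=
  ∑ c ∈ boundedFun hE (T.erase r), if Spans (BurntBy hE c) r T then
    ∏ v ∈ T.erase r, truncGeom q hE.toFinset.card (c v) else 0

/-- A vertex `v` outside `T` stays unburnt when its value is at least its number of edges to `T`, a
tail event of weight `q` to that number. The truncation point `|E|` is at least every such number.
-/
lemma sum_boundedFun_component {q : R} {r : α} {T S : Finset α} (hTS : T ⊆ S) (hr : r ∈ T) :
    ∑ c ∈ boundedFun hE (S.erase r),
      (if Spans (BurntBy hE c) r T ∧ ∀ v ∈ S \ T, ¬ BurntBy hE c v T then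
        ∏ v ∈ S.erase r, truncGeom q hE.toFinset.card (c v) else 0) =
      parkSum hE q r T * q ^ (edgesBetween hE T S).card := by
  have hS : S.erase r = T.erase r ∪ S \ T := by
    ext v
    simp only [mem_erase, mem_union, mem_sdiff]
    have := @hTS v
    by_cases hv : v = r
    · subst hv
      simp [hr]
    · tauto
  have hdis : Disjoint (T.erase r) (S \ T) :=
    disjoint_sdiff.mono_left (erase_subset r T)
  have := sum_finsupp_union_mul hdis (t := range (hE.toFinset.card + 1))
    (fun c => if Spans (BurntBy hE c) r T then
      ∏ v ∈ T.erase r, truncGeom q hE.toFinset.card (c v) else 0)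
    (fun v k => if (edgesTo hE v T).card ≤ k then truncGeom q hE.toFinset.card k else 0)
  simp only [sum_truncGeom q (card_edgesTo_le hE _ T)] at this
  rw [prod_pow_eq_pow_sum, ← card_edgesBetween] at this
  rw [parkSum, boundedFun, boundedFun, ← this, ← hS]
  refine sum_congr rfl fun c _ => ?_
  have h1 : ∀ v ∈ T, v ≠ r → c.filter (· ∈ T.erase r) v = c v := fun v hv hvr =>
    Finsupp.filter_apply_pos _ _ (mem_erase.2 ⟨hvr, hv⟩)
  have h2 : Spans (BurntBy hE (c.filter (· ∈ T.erase r))) r T ↔ Spans (BurntBy hE c) r T :=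
    ⟨fun h => h.burntBy_anti hE fun v hv hvr => (h1 v hv hvr).ge,
      fun h => h.burntBy_anti hE fun v hv hvr => (h1 v hv hvr).le⟩
  have h3 : ∏ v ∈ T.erase r, truncGeom q hE.toFinset.card (c.filter (· ∈ T.erase r) v) =
      ∏ v ∈ T.erase r, truncGeom q hE.toFinset.card (c v) :=
    prod_congr rfl fun v hv => by rw [Finsupp.filter_apply_pos _ _ hv]
  simp only [h2, h3]
  by_cases h4 : ∀ v ∈ S \ T, ¬ BurntBy hE c v T
  · rw [hS, prod_union hdis]
    have h5 : ∏ v ∈ S \ T, (if (edgesTo hE v T).card ≤ c v then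
        truncGeom q hE.toFinset.card (c v) else 0) =
        ∏ v ∈ S \ T, truncGeom q hE.toFinset.card (c v) :=
      prod_congr rfl fun v hv => if_pos (not_lt.1 (h4 v hv))
    rw [h5]
    by_cases h6 : Spans (BurntBy hE c) r T
    · rw [if_pos ⟨h6, h4⟩, if_pos h6]
    · rw [if_neg fun h => h6 h.1, if_neg h6, zero_mul]
  · rw [if_neg fun h => h4 h.2]
    push Not at h4
    obtain ⟨v, hv, hb⟩ := h4
    rw [prod_eq_zero hv (if_neg (not_le.2 hb)), mul_zero]

/-- Dhar's burning algorithm: every function is a parking function on the set burnt from `r` and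
is large off that set. -/
lemma sum_parkSum (q : R) {r : α} {S : Finset α} (hr : r ∈ S) :
    ∑ T ∈ S.powerset.filter (r ∈ ·), parkSum hE q r T * q ^ (edgesBetween hE T S).card = 1 := by
  have h1 : ∑ c ∈ boundedFun hE (S.erase r),
      ∏ v ∈ S.erase r, truncGeom q hE.toFinset.card (c v) = 1 := by
    rw [boundedFun, sum_finsupp_prod (S.erase r) (range (hE.toFinset.card + 1))
      (fun _ k => truncGeom q hE.toFinset.card k)]
    refine prod_eq_one fun v _ => ?_
    simpa using sum_truncGeom q (Nat.zero_le hE.toFinset.card)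
  rw [← h1, sum_congr rfl fun T hT => (sum_boundedFun_component hE
    (mem_powerset.1 (mem_filter.1 hT).1) (mem_filter.1 hT).2).symm, sum_comm]
  exact sum_congr rfl fun c _ => sum_ite_of_existsUnique
    (existsUnique_spans (burntBy_monotone hE c) hr) _

lemma edgesBetween_self (S : Finset α) : edgesBetween hE S S = ∅ := by
  simp [edgesBetween]

/-- The reliability is the weight of the parking functions. -/
lemma relSum_eq_parkSum (q : R) {r : α} {S : Finset α} (hr : r ∈ S) :
    relSum hE q r S = parkSum hE q r S := by
  induction S using Finset.strongInduction with
  | H S ih =>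
    -- The term `T = S` has an empty cut; the other terms agree by induction and cancel.
    have hS : S ∈ S.powerset.filter (r ∈ ·) := by simp [hr]
    have h := (sum_relSum hE q hr).trans (sum_parkSum hE q hr).symm
    rw [← add_sum_erase _ _ hS, ← add_sum_erase _ _ hS, edgesBetween_self, card_empty,
      pow_zero, mul_one, mul_one] at h
    have h2 : ∀ T ∈ (S.powerset.filter (r ∈ ·)).erase S, relSum hE q r T = parkSum hE q r T := by
      intro T hT
      simp only [mem_erase, mem_filter, mem_powerset] at hT
      exact ih T (hT.2.1.ssubset_of_ne hT.1) hT.2.2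
    rw [sum_congr rfl fun T hT => by rw [h2 T hT]] at h
    exact add_right_cancel h

end Recursion

/-! ### Parking functions as a pure order ideal, and the root bounds -/

section Purity

variable {α β : Type*} {G : Graph α β} (hE : G.edgeSet.Finite)

/-- The bound on values is automatic: testing `U = {v}` shows that `c v` is below the number of
edges at `v`. -/
lemma mem_parking {r : α} {T : Finset α} {c : α →₀ ℕ} :
    c ∈ parking hE r T ↔ c.support ⊆ T.erase r ∧ Spans (BurntBy hE c) r T := by
  simp only [parking, boundedFun, mem_filter, mem_finsupp_iff, mem_range]
  refine ⟨fun h => ⟨h.1.1, h.2⟩, fun h => ⟨⟨h.1, fun v hv => ?_⟩, h.2⟩⟩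
  rw [mem_erase] at hv
  obtain ⟨u, hu, hb⟩ := h.2 {v} (by simpa using hv.2) (singleton_nonempty v)
    (by simpa using hv.1.symm)
  rw [mem_singleton] at hu
  subst hu
  exact (hb.trans_le (card_edgesTo_le hE _ _)).trans (Nat.lt_succ_self _)

lemma parking_of_le {r : α} {T : Finset α} {c c' : α →₀ ℕ} (hc : c ∈ parking hE r T)
    (hle : c' ≤ c) : c' ∈ parking hE r T := by
  rw [mem_parking] at hc ⊢
  refine ⟨fun v hv => hc.1 ?_, hc.2.burntBy_anti hE fun v _ _ => hle v⟩
  rw [Finsupp.mem_support_iff] at hv ⊢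
  have := hle v
  omega

lemma parkSum_eq {R : Type*} [CommRing R] (q : R) (r : α) (T : Finset α) :
    parkSum hE q r T =
      (1 - q) ^ (T.erase r).card * ∑ c ∈ parking hE r T, q ^ c.degree := by
  rw [parkSum, ← sum_filter, mul_sum]
  refine sum_congr rfl fun c hc => ?_
  have hmem := (mem_parking hE).1 hc
  have hdeg : c.degree = ∑ v ∈ T.erase r, c v :=
    sum_subset hmem.1 fun v _ hv => Finsupp.notMem_support_iff.1 hv
  rw [← prod_const, hdeg, ← prod_pow_eq_pow_sum,
    ← prod_mul_distrib]
  refine prod_congr rfl fun v hv => ?_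
  rw [mem_erase] at hv
  obtain ⟨u, hu, hb⟩ := hmem.2 {v} (by simpa using hv.2) (singleton_nonempty v)
    (by simpa using hv.1.symm)
  rw [mem_singleton] at hu
  subst hu
  rw [truncGeom, if_pos (hb.trans_le (card_edgesTo_le hE _ _))]

lemma edgesIn_singleton [G.Loopless] (v : α) : edgesIn hE {v} = ∅ := by
  refine eq_empty_of_forall_notMem fun e he => ?_
  obtain ⟨x, hx, y, hy, hl⟩ := (mem_edgesIn hE).1 he
  rw [mem_singleton] at hx hy
  exact hl.ne (hx.trans hy.symm)

lemma card_edgesIn_insert [G.Loopless] {v : α} {T : Finset α} (hv : v ∉ T) :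
    (edgesIn hE (insert v T)).card = (edgesIn hE T).card + (edgesTo hE v T).card := by
  have h : insert v T \ T = {v} := by
    ext x
    simp only [mem_sdiff, mem_insert, mem_singleton]
    constructor
    · tauto
    · rintro rfl
      exact ⟨Or.inl rfl, hv⟩
  rw [edgesIn_eq_union hE (subset_insert v T), card_union_of_disjoint
    (disjoint_edgesIn_union hE T _), card_union_of_disjoint (disjoint_edgesBetween_edgesIn hE T _),
    card_edgesBetween, h, edgesIn_singleton, sum_singleton, card_empty, add_zero]

/-- Every parking function lies below one of degree `|E| - |V| + 1`. -/
lemma exists_le_parking_degree [G.Loopless] {r : α} {S : Finset α} (hr : r ∈ S) {c : α →₀ ℕ}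
    (hc : c ∈ parking hE r S) :
    ∃ c' ∈ parking hE r S, c ≤ c' ∧ c'.degree + S.card = (edgesIn hE S).card + 1 := by
  rw [mem_parking] at hc
  -- Burn `S` one vertex at a time according to `c`. A new vertex with `d` edges to the burnt set
  -- `T` receives `d - 1`, the largest value at which it still burns. This adds `d - 1` to the
  -- degree, `1` to the vertex count and `d` to the edge count.
  have key : ∀ n < S.card, ∃ T ⊆ S, r ∈ T ∧ T.card = n + 1 ∧ ∃ c' ∈ parking hE r T,
      (∀ v ∈ T, c v ≤ c' v) ∧ c'.degree + T.card = (edgesIn hE T).card + 1 := by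
    intro n
    induction n with
    | zero =>
      intro _
      have hcr : c r = 0 := Finsupp.notMem_support_iff.1 fun h => by simpa using hc.1 h
      exact ⟨{r}, by simpa using hr, by simp, by simp, 0,
        (mem_parking hE).2 ⟨by simp, spans_singleton _ r⟩, by simp [hcr],
        by simp [edgesIn_singleton]⟩
    | succ n ih =>
      intro hn
      obtain ⟨T, hTS, hrT, hT, c', hc', hle, hdeg⟩ := ih (by omega)
      have hne : (S \ T).Nonempty := sdiff_nonempty.2 fun h => by
        have := card_le_card h
        omega
      obtain ⟨v, hv, hb⟩ := hc.2 (S \ T) sdiff_subset hne (by simp [hrT])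
      rw [Finset.sdiff_sdiff_eq_self hTS] at hb
      rw [mem_sdiff] at hv
      rw [mem_parking] at hc'
      have hvr : v ≠ r := fun h => hv.2 (h ▸ hrT)
      have hv0 : c' v = 0 := Finsupp.notMem_support_iff.1 fun h =>
        hv.2 (mem_of_mem_erase (hc'.1 h))
      unfold BurntBy at hb
      set d := (edgesTo hE v T).card with hd
      have hval : ∀ u ∈ T, (c' + Finsupp.single v (d - 1)) u = c' u := fun u hu => by
        have huv : u ≠ v := fun h => hv.2 (h ▸ hu)
        rw [Finsupp.add_apply, Finsupp.single_eq_of_ne huv, add_zero]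
      have hvalv : (c' + Finsupp.single v (d - 1)) v = d - 1 := by
        rw [Finsupp.add_apply, Finsupp.single_eq_same, hv0, zero_add]
      refine ⟨insert v T, insert_subset hv.1 hTS, mem_insert_of_mem hrT, by
        rw [card_insert_of_notMem hv.2, hT], c' + Finsupp.single v (d - 1),
        (mem_parking hE).2 ⟨?_, ?_⟩, ?_, ?_⟩
      · refine Finsupp.support_add.trans (union_subset ?_ ?_)
        · exact hc'.1.trans (erase_subset_erase r (subset_insert v T))
        · refine Finsupp.support_single_subset.trans ?_
          simp [hvr]
      · refine Spans.insert (burntBy_monotone hE _)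
          (hc'.2.burntBy_anti hE fun u hu _ => (hval u hu).le) ?_
        rw [BurntBy, hvalv]
        omega
      · intro u hu
        rcases mem_insert.1 hu with rfl | hu
        · rw [hvalv]
          omega
        · rw [hval u hu]
          exact hle u hu
      · rw [map_add, Finsupp.degree_single, card_insert_of_notMem hv.2,
          card_edgesIn_insert hE hv.2]
        omega
  have hpos : 0 < S.card := card_pos.2 ⟨r, hr⟩
  obtain ⟨T, hTS, -, hT, c', hc', hle, hdeg⟩ := key (S.card - 1) (by omega)
  obtain rfl := eq_of_subset_of_card_le hTS (by omega)
  refine ⟨c', hc', fun v => ?_, hdeg⟩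
  by_cases hv : v ∈ T
  · exact hle v hv
  · rw [Finsupp.notMem_support_iff.1 fun h => hv (mem_of_mem_erase (hc.1 h))]
    exact Nat.zero_le _

/-- The number of parking functions of degree `i`. -/
noncomputable def numParking (r : α) (T : Finset α) (i : ℕ) : ℕ :=
  ((parking hE r T).filter fun c => c.degree = i).card

/-- Below the top degree, `c` is strictly below a parking function and can be raised by one at some
vertex. The raised function recovers `c` once that vertex, one of at most `K` in its support, is
known. -/
lemma numParking_le_mul [G.Loopless] {r : α} {S : Finset α} (hr : r ∈ S) {K i : ℕ}
    (hK : ∀ c ∈ parking hE r S, c.support.card ≤ K) (hi : i + S.card < (edgesIn hE S).card + 1) :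
    numParking hE r S i ≤ K * numParking hE r S (i + 1) := by
  have hsub : (parking hE r S).filter (fun c => c.degree = i) ⊆
      ((parking hE r S).filter fun c => c.degree = i + 1).biUnion
        fun c => c.support.image fun v => c - Finsupp.single v 1 := by
    intro c hc
    rw [mem_filter] at hc
    obtain ⟨c', hc', hle, hdeg⟩ := exists_le_parking_degree hE hr hc.1
    have hex : ∃ v, c v < c' v := by
      by_contra! h
      have : c = c' := le_antisymm hle h
      subst this
      omega
    obtain ⟨v, hv⟩ := hex
    simp only [mem_biUnion, mem_filter, mem_image]
    refine ⟨c + Finsupp.single v 1, ⟨parking_of_le hE hc' fun u => ?_, ?_⟩, v, ?_, ?_⟩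
    · rw [Finsupp.add_apply]
      by_cases hu : u = v
      · subst hu
        rw [Finsupp.single_eq_same]
        exact hv
      · rw [Finsupp.single_eq_of_ne hu]
        exact hle u
    · rw [map_add, Finsupp.degree_single, hc.2]
    · simp
    · exact add_tsub_cancel_right _ _
  rw [numParking, numParking, mul_comm]
  refine (card_le_card hsub).trans (card_biUnion_le_card_mul _ _ _ fun c hc => ?_)
  exact card_image_le.trans (hK c (mem_filter.1 hc).1)

lemma zero_mem_parking {r : α} {S : Finset α}
    (hS : Spans (LinkedTo G hE.toFinset) r S) : 0 ∈ parking hE r S := by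
  refine (mem_parking hE).2 ⟨by simp, hS.mono_rel ?_⟩
  rintro v - - W - ⟨e, -, w, hw, hl⟩
  exact card_pos.2 ⟨e, (mem_edgesTo hE).2 ⟨w, hw, hl⟩⟩

lemma norm_le_of_relSum_eq_zero [G.Loopless] {r : α} {S : Finset α} (hr : r ∈ S)
    (hS : Spans (LinkedTo G hE.toFinset) r S) {K : ℕ}
    (hK : ∀ c ∈ parking hE r S, c.support.card ≤ K) (hK1 : 2 ≤ S.card → 1 ≤ K) {z : ℂ}
    (hz : relSum hE z r S = 0) : ‖z‖ ≤ K := by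
  rw [relSum_eq_parkSum hE z hr, parkSum_eq, mul_eq_zero] at hz
  rcases hz with hz | hz
  -- The factor `(1 - z) ^ (|S| - 1)` vanishes only at `z = 1` with `|S| ≥ 2`, where `1 ≤ K` is
  -- assumed.
  · obtain ⟨h1, h2⟩ := pow_eq_zero_iff'.1 hz
    rw [card_erase_of_mem hr] at h2
    rw [← sub_eq_zero.1 h1, norm_one]
    exact_mod_cast hK1 (by omega)
  · obtain ⟨c₀, hc₀, -, hdeg₀⟩ := exists_le_parking_degree hE hr (zero_mem_parking hE hS)
    have hle : ∀ c ∈ parking hE r S, c.degree ≤ c₀.degree := by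
      intro c hc
      obtain ⟨c', -, hle, hdeg⟩ := exists_le_parking_degree hE hr hc
      have := Finsupp.degree_mono hle
      omega
    refine norm_le_of_sum_eq_zero (h := fun i => (numParking hE r S i : ℝ)) (g := c₀.degree)
      (Nat.cast_nonneg K) ?_ (fun i => Nat.cast_nonneg _) ?_ ?_
    · exact Nat.cast_pos.2 (card_pos.2 ⟨c₀, mem_filter.2 ⟨hc₀, rfl⟩⟩)
    · intro i hi
      exact_mod_cast numParking_le_mul hE hr hK (by omega)
    · rw [← hz, ← sum_fiberwise_of_maps_to (g := fun c : α →₀ ℕ => c.degree)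
        (t := range (c₀.degree + 1)) fun c hc => mem_range.2 (Nat.lt_succ_of_le (hle c hc))]
      refine sum_congr rfl fun i _ => ?_
      rw [sum_congr rfl fun c hc => by rw [(mem_filter.1 hc).2], sum_const, nsmul_eq_mul,
        numParking]
      simp

lemma norm_le_card_sub_one [G.Loopless] {r : α} {S : Finset α} (hr : r ∈ S)
    (hS : Spans (LinkedTo G hE.toFinset) r S) {z : ℂ} (hz : relSum hE z r S = 0) :
    ‖z‖ ≤ (S.card : ℝ) - 1 := by
  have h := norm_le_of_relSum_eq_zero hE hr hS (K := (S.erase r).card)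
    (fun c hc => card_le_card ((mem_parking hE).1 hc).1)
    (fun h => by rw [card_erase_of_mem hr]; omega) hz
  rwa [card_erase_of_mem hr, Nat.cast_sub (card_pos.2 ⟨r, hr⟩), Nat.cast_one] at h

lemma norm_le_card_sub_two [G.Loopless] {r : α} {S : Finset α} (hr : r ∈ S)
    (hS : Spans (LinkedTo G hE.toFinset) r S) (hcard : 3 ≤ S.card)
    (hsimple : ∀ v ∈ S, (edgesTo hE v {r}).card ≤ 1) {z : ℂ} (hz : relSum hE z r S = 0) :
    ‖z‖ ≤ (S.card : ℝ) - 2 := by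
  have hcr := card_erase_of_mem hr
  have h := norm_le_of_relSum_eq_zero hE hr hS (K := S.card - 2) (fun c hc => ?_)
    (fun h => by omega) hz
  · rwa [Nat.cast_sub (by omega), Nat.cast_ofNat] at h
  · rw [mem_parking] at hc
    -- The first vertex to burn is burnt by `r` alone, through at most one edge, so its value is `0`
    -- and it drops out of the support.
    obtain ⟨v, hv, hb⟩ := hc.2 (S.erase r) (erase_subset r S) (card_pos.1 (by omega)) (by simp)
    have hsd : S \ S.erase r = {r} := by
      ext x
      simp only [mem_sdiff, mem_erase, mem_singleton]
      constructor
      · tauto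
      · rintro rfl
        simp [hr]
    rw [hsd] at hb
    have hv0 : c v = 0 := by
      have := hb.trans_le (hsimple v (mem_of_mem_erase hv))
      omega
    have hsub : c.support ⊆ (S.erase r).erase v := fun u hu =>
      mem_erase.2 ⟨fun h => by simp [h, hv0] at hu, hc.1 hu⟩
    have := card_le_card hsub
    rw [card_erase_of_mem hv] at this
    omega

end Purity

/-! ### Reduction to vertex sets without cut vertices, and to blocks -/

section CutVertices

variable {α β : Type*} {G : Graph α β} (hE : G.edgeSet.Finite)

/-- Edges are undirected: if the old root lies in `U`, an edge entering the complement of `U` also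
enters `U` when reversed. -/
lemma spans_linkedTo_of_mem {A : Finset β} {r r' : α} {T : Finset α}
    (hr' : r' ∈ T) (h : Spans (LinkedTo G A) r T) :
    Spans (LinkedTo G A) r' T := by
  intro U hU hne hrU
  by_cases hr : r ∈ U
  · obtain ⟨v, hv, e, he, w, hw, hl⟩ := h (T \ U) sdiff_subset ⟨r', mem_sdiff.2 ⟨hr', hrU⟩⟩
      (by simp [hr])
    rw [Finset.sdiff_sdiff_eq_self hU] at hw
    exact ⟨w, hw, e, he, v, hv, hl.symm⟩
  · exact h U hU hne hr

lemma relSum_eq_of_mem {R : Type*} [CommRing R] (q : R) {r r' : α} {T : Finset α} (hr : r ∈ T)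
    (hr' : r' ∈ T) : relSum hE q r T = relSum hE q r' T := by
  refine sum_congr rfl fun A _ => ?_
  have : Spans (LinkedTo G A) r T ↔ Spans (LinkedTo G A) r' T :=
    ⟨spans_linkedTo_of_mem hr', spans_linkedTo_of_mem hr⟩
  simp only [this]

/-- `S₁` and `S₂` share only the vertex `x`, and no edge avoiding `x` joins them. -/
structure IsSplit (G : Graph α β) (x : α) (S₁ S₂ : Finset α) : Prop where
  left_mem : x ∈ S₁
  right_mem : x ∈ S₂
  eq_of_mem : ∀ y ∈ S₁, y ∈ S₂ → y = x
  not_isLink : ∀ e, ∀ a ∈ S₁, ∀ b ∈ S₂, a ≠ x → b ≠ x → ¬ G.IsLink e a b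

lemma IsSplit.symm {x : α} {S₁ S₂ : Finset α} (h : IsSplit G x S₁ S₂) : IsSplit G x S₂ S₁ where
  left_mem := h.right_mem
  right_mem := h.left_mem
  eq_of_mem y h1 h2 := h.eq_of_mem y h2 h1
  not_isLink e a ha b hb hax hbx hl := h.not_isLink e b hb a ha hbx hax hl.symm

/-- An edge from `S₁` minus `x` can reach `S₂` only at `x`, which belongs to `S₁`. -/
lemma IsSplit.spans_left {A : Finset β} {x : α} {S₁ S₂ : Finset α} (h : IsSplit G x S₁ S₂)
    (hS : Spans (LinkedTo G A) x (S₁ ∪ S₂)) : Spans (LinkedTo G A) x S₁ := by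
  intro U hU hne hx
  obtain ⟨v, hv, e, he, w, hw, hl⟩ := hS U (hU.trans subset_union_left) hne hx
  have hvx : v ≠ x := fun h => hx (h ▸ hv)
  refine ⟨v, hv, e, he, w, ?_, hl⟩
  rw [mem_sdiff, mem_union] at hw
  refine mem_sdiff.2 ⟨hw.1.elim id fun hw2 => ?_, hw.2⟩
  by_cases hwx : w = x
  · exact hwx ▸ h.left_mem
  · exact (h.not_isLink e v (hU hv) w hw2 hvx hwx hl).elim

lemma Spans.union {D : α → Finset α → Prop} (hD : ∀ v, Monotone (D v)) {x : α}
    {S₁ S₂ : Finset α} (h₁ : Spans D x S₁) (h₂ : Spans D x S₂) : Spans D x (S₁ ∪ S₂) := by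
  intro U hU hne hx
  obtain ⟨u, hu⟩ := hne
  have key : ∀ S ⊆ S₁ ∪ S₂, Spans D x S → u ∈ S → ∃ v ∈ U, D v ((S₁ ∪ S₂) \ U) := by
    intro S hS h huS
    obtain ⟨v, hv, hvD⟩ := h (S ∩ U) inter_subset_left ⟨u, mem_inter.2 ⟨huS, hu⟩⟩ (by simp [hx])
    refine ⟨v, (mem_inter.1 hv).2, hD v ?_ hvD⟩
    rw [sdiff_inter_self_left]
    exact sdiff_subset_sdiff hS le_rfl
  rcases mem_union.1 (hU hu) with h | h
  · exact key S₁ subset_union_left h₁ h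
  · exact key S₂ subset_union_right h₂ h

/-- The reliability is multiplicative over a cut vertex. -/
lemma IsSplit.relSum_union [G.Loopless] {R : Type*} [CommRing R] (q : R) {x : α}
    {S₁ S₂ : Finset α} (h : IsSplit G x S₁ S₂) :
    relSum hE q x (S₁ ∪ S₂) = relSum hE q x S₁ * relSum hE q x S₂ := by
  have hdis : Disjoint (edgesIn hE S₁) (edgesIn hE S₂) := by
    refine disjoint_left.2 fun e h1 h2 => ?_
    obtain ⟨a, ha, b, hb, hl⟩ := (mem_edgesIn hE).1 h1
    rw [mem_edgesIn_of_isLink hE hl] at h2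
    exact hl.ne ((h.eq_of_mem a ha h2.1).trans (h.eq_of_mem b hb h2.2).symm)
  have hun : edgesIn hE (S₁ ∪ S₂) = edgesIn hE S₁ ∪ edgesIn hE S₂ := by
    ext e
    rw [mem_union]
    constructor
    · intro he
      obtain ⟨a, ha, b, hb, hl⟩ := (mem_edgesIn hE).1 he
      rw [mem_edgesIn_of_isLink hE hl, mem_edgesIn_of_isLink hE hl]
      have h1 := h.not_isLink e a
      have h2 := h.symm.not_isLink e a
      have h3 := h.left_mem
      have h4 := h.right_mem
      rw [mem_union] at ha hb
      by_cases hax : a = x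
      · subst hax
        tauto
      · by_cases hbx : b = x
        · subst hbx
          tauto
        · have h1' := fun hb => (h1 · b hb hax hbx hl)
          have h2' := fun hb => (h2 · b hb hax hbx hl)
          tauto
    · intro he
      rcases he with he | he <;> obtain ⟨a, ha, b, hb, hl⟩ := (mem_edgesIn hE).1 he <;>
        rw [mem_edgesIn_of_isLink hE hl] <;> simp [ha, hb]
  rw [relSum, relSum, relSum, ← sum_powerset_union_mul hdis, ← hun]
  refine sum_congr rfl fun A hA => ?_
  rw [mem_powerset, hun] at hA
  have h1 : Spans (LinkedTo G (A ∩ edgesIn hE S₁)) x S₁ ↔ Spans (LinkedTo G A) x S₁ :=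
    spans_linkedTo_congr hE (by rw [inter_assoc, inter_self])
  have h2 : Spans (LinkedTo G (A ∩ edgesIn hE S₂)) x S₂ ↔ Spans (LinkedTo G A) x S₂ :=
    spans_linkedTo_congr hE (by rw [inter_assoc, inter_self])
  have h3 : Spans (LinkedTo G A) x (S₁ ∪ S₂) ↔
      Spans (LinkedTo G A) x S₁ ∧ Spans (LinkedTo G A) x S₂ :=
    ⟨fun hs => ⟨h.spans_left hs, h.symm.spans_left (by rwa [union_comm])⟩,
      fun hs => hs.1.union (linkedTo_monotone A) hs.2⟩
  rw [hun, stateWeight_union hdis hA]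
  simp only [h1, h2, h3]
  by_cases h4 : Spans (LinkedTo G A) x S₁ <;> by_cases h5 : Spans (LinkedTo G A) x S₂ <;>
    simp [h4, h5]

/-- A walk from `r` cannot enter a set that no edge enters. Conversely, the set of vertices
unreachable from `r`, if nonempty, would be entered from a reachable one. -/
lemma connected_iff_spans {H : Graph α β} {S : Finset α} (hS : (S : Set α) = H.vertexSet)
    {r : α} (hr : r ∈ S) : H.Connected ↔ Spans (fun v W => ∃ w ∈ W, H.Adj v w) r S := by
  have hmem : ∀ v, v ∈ H.vertexSet ↔ v ∈ S := fun v => by rw [← hS, mem_coe]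
  constructor
  · rintro ⟨-, h⟩ U hU ⟨u, hu⟩ hrU
    have hreach := (h r ((hmem r).2 hr) u ((hmem u).2 (hU hu))).2.2
    by_contra! hno
    have : ∀ v, Relation.ReflTransGen H.Adj r v → v ∉ U := by
      intro v hv
      induction hv with
      | refl => exact hrU
      | @tail b c _ hbc ih =>
        intro hc
        exact hno c hc b (mem_sdiff.2 ⟨(hmem b).1 hbc.left_mem, ih⟩) hbc.symm
    exact this u hreach hu
  · intro h
    have hall : ∀ v ∈ S, Relation.ReflTransGen H.Adj r v := by
      by_contra! hno
      obtain ⟨v, hv, hnv⟩ := hno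
      obtain ⟨u, hu, w, hw, hl⟩ := h (S.filter fun v => ¬ Relation.ReflTransGen H.Adj r v)
        (filter_subset _ _) ⟨v, mem_filter.2 ⟨hv, hnv⟩⟩ (by simp [Relation.ReflTransGen.refl])
      rw [mem_filter] at hu
      simp only [mem_sdiff, mem_filter, not_and, not_not] at hw
      exact hu.2 ((hw.2 hw.1).tail hl.symm)
    refine ⟨⟨r, (hmem r).2 hr⟩, fun x hx y hy => ⟨hx, hy, ?_⟩⟩
    refine Relation.ReflTransGen.trans ?_ (hall y ((hmem y).1 hy))
    exact Std.Symm.symm _ _ (hall x ((hmem x).1 hx))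

lemma restrict_connected_iff {S : Finset α} (hS : (S : Set α) = G.vertexSet) {r : α} (hr : r ∈ S)
    (A : Finset β) : (G.restrict (A : Set β)).Connected ↔ Spans (LinkedTo G A) r S := by
  rw [connected_iff_spans (H := G.restrict (A : Set β)) hS hr]
  refine ⟨fun h => h.mono_rel ?_, fun h => h.mono_rel ?_⟩
  · rintro v - - W - ⟨w, hw, e, he, hl⟩
    exact ⟨e, he, w, hw, hl⟩
  · rintro v - - W - ⟨e, he, w, hw, hl⟩
    exact ⟨w, hw, e, he, hl⟩

lemma induce_connected {S : Finset α} {r : α} (hr : r ∈ S)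
    (h : Spans (LinkedTo G hE.toFinset) r S) : (G.induce (S : Set α)).Connected := by
  rw [connected_iff_spans (H := G.induce (S : Set α)) rfl hr]
  refine h.mono_rel ?_
  rintro v hv - W hW ⟨e, -, w, hw, hl⟩
  exact ⟨w, hw, e, hl, hv, hW hw⟩

lemma aeval_reliability {S : Finset α} (hS : (S : Set α) = G.vertexSet) {r : α} (hr : r ∈ S)
    (z : ℂ) : Polynomial.aeval z (G.reliability hE) = relSum hE z r S := by
  have hin : edgesIn hE S = hE.toFinset := by
    refine filter_true_of_mem fun e _ v hv => ?_
    rw [← mem_coe, hS]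
    exact hv.vertex_mem
  rw [reliability, map_sum, relSum, hin, sum_filter]
  refine sum_congr rfl fun A _ => ?_
  simp only [restrict_connected_iff hS hr, stateWeight]
  split_ifs <;> simp

lemma exists_isSplit_of_isCutVertex {S : Finset α} {x : α}
    (h : (G.induce (S : Set α)).IsCutVertex x) :
    ∃ S₁ S₂, IsSplit G x S₁ S₂ ∧ S₁ ∪ S₂ = S ∧ S₁ ⊂ S ∧ S₂ ⊂ S := by
  obtain ⟨hx, u, v, hux, hvx, ⟨hu, hv, -⟩, hn⟩ := h
  change x ∈ (S : Set α) at hx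
  change u ∈ (S : Set α) at hu
  change v ∈ (S : Set α) at hv
  rw [mem_coe] at hx hu hv
  set H := (G.induce (S : Set α)).deleteVerts {x} with hH
  have hnv : ¬ Relation.ReflTransGen H.Adj u v := fun hr => hn
    ⟨⟨hu, by simpa using hux⟩, ⟨hv, by simpa using hvx⟩, hr⟩
  -- One side consists of the vertices reachable from `u` after deleting `x`, the other of the rest,
  -- with `x` added to both. Each is proper: the first misses `v`, the second misses `u`.
  refine ⟨S.filter fun w => w = x ∨ Relation.ReflTransGen H.Adj u w,
    S.filter fun w => w = x ∨ ¬ Relation.ReflTransGen H.Adj u w, ⟨by simp [hx], by simp [hx], ?_, ?_⟩,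
    ?_, ?_, ?_⟩
  · intro y h1 h2
    rw [mem_filter] at h1 h2
    tauto
  · intro e a ha b hb hax hbx hl
    rw [mem_filter] at ha hb
    have hua : Relation.ReflTransGen H.Adj u a := ha.2.resolve_left hax
    refine (hb.2.resolve_left hbx) (hua.tail ⟨e, ?_⟩)
    rw [hH, deleteVerts_isLink]
    exact ⟨⟨hl, ha.1, hb.1⟩, by simpa using hax, by simpa using hbx⟩
  · rw [← filter_or]
    exact filter_true_of_mem fun w _ => by tauto
  · exact filter_ssubset.2 ⟨v, hv, by tauto⟩
  · exact filter_ssubset.2 ⟨u, hu, by simp [hux, Relation.ReflTransGen.refl]⟩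

/-- A root of the reliability is a root for some vertex set inducing a connected subgraph without
cut vertices. -/
lemma exists_relSum_eq_zero_of_no_cutVertex [G.Loopless] {z : ℂ} {r : α} {S : Finset α}
    (hr : r ∈ S) (hS : Spans (LinkedTo G hE.toFinset) r S) (hz : relSum hE z r S = 0) :
    ∃ T ⊆ S, T.Nonempty ∧ (∀ t ∈ T, Spans (LinkedTo G hE.toFinset) t T ∧ relSum hE z t T = 0) ∧
      ∀ x, ¬ (G.induce (T : Set α)).IsCutVertex x := by
  induction S using Finset.strongInduction generalizing r with
  | H S ih =>
    by_cases hcut : ∃ x, (G.induce (S : Set α)).IsCutVertex x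
    · obtain ⟨x, hx⟩ := hcut
      obtain ⟨S₁, S₂, hsp, rfl, h1, h2⟩ := exists_isSplit_of_isCutVertex hx
      have hxS : x ∈ S₁ ∪ S₂ := mem_union_left _ hsp.left_mem
      have hSx := spans_linkedTo_of_mem hxS hS
      rw [relSum_eq_of_mem hE z hr hxS, hsp.relSum_union, mul_eq_zero] at hz
      rcases hz with hz | hz
      · obtain ⟨T, hT, h⟩ := ih S₁ h1 hsp.left_mem (hsp.spans_left hSx) hz
        exact ⟨T, hT.trans h1.1, h⟩
      · obtain ⟨T, hT, h⟩ := ih S₂ h2 hsp.right_mem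
          (hsp.symm.spans_left (by rwa [union_comm])) hz
        exact ⟨T, hT.trans h2.1, h⟩
    · push Not at hcut
      exact ⟨S, Subset.rfl, ⟨r, hr⟩, fun t ht => ⟨spans_linkedTo_of_mem ht hS,
        by rw [relSum_eq_of_mem hE z ht hr, hz]⟩, hcut⟩

lemma exists_isBlock_ge (hV : G.vertexSet.Finite) (hE : G.edgeSet.Finite) {H : Graph α β}
    (hle : H ≤ G) (hconn : H.Connected) (hcut : ∀ x, ¬ H.IsCutVertex x) :
    ∃ B, H ≤ B ∧ G.IsBlock B := by
  -- A subgraph of `G` is determined by its vertex and edge sets, which are subsets of finite sets.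
  have hfin : {H : Graph α β | H ≤ G}.Finite := by
    refine Set.Finite.of_finite_image (f := fun H => (H.vertexSet, H.edgeSet))
      ((hV.finite_subsets.prod hE.finite_subsets).subset ?_) ?_
    · rintro _ ⟨H, hH, rfl⟩
      exact ⟨IsSubgraph.vertexSet_mono hH, IsSubgraph.edgeSet_mono hH⟩
    · intro H₁ h₁ H₂ h₂ h
      rw [Prod.mk.injEq] at h
      exact Compatible.ext h.1 h.2 (Compatible.of_le_le h₁ h₂)
  exact (hfin.subset fun H (h : H ≤ G ∧ H.Connected ∧ ∀ x, ¬ H.IsCutVertex x) =>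
    h.1).exists_le_maximal ⟨hle, hconn, hcut⟩

end CutVertices

end Graph

/-! ### The bounds in terms of the largest block order -/

theorem mainTheorem2 {α β : Type*} (G : Graph α β)
    (hV : G.vertexSet.Finite) (hE : G.edgeSet.Finite) (hloop : G.Loopless)
    (hconn : G.Connected) (hn : 2 ≤ G.vertexSet.ncard)
    (s : ℕ) (hs : IsGreatest {k : ℕ | ∃ B : Graph α β, G.IsBlock B ∧ B.vertexSet.ncard = k} s) :
    (∀ z : ℂ, Polynomial.aeval z (G.reliability hE) = 0 → ‖z‖ ≤ (s : ℝ) - 1) ∧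
    (3 ≤ s →
      (∀ B : Graph α β, G.IsBlock B → B.vertexSet.ncard = s →
        ∃ w ∈ B.vertexSet, B.NoMultipleEdgesAt w) →
      ∀ z : ℂ, Polynomial.aeval z (G.reliability hE) = 0 → ‖z‖ ≤ (s : ℝ) - 2) ∧
    (3 ≤ s → G.Simple →
      ∀ z : ℂ, Polynomial.aeval z (G.reliability hE) = 0 → ‖z‖ ≤ (s : ℝ) - 2) := by
  classical
  have key : ∀ z : ℂ, Polynomial.aeval z (G.reliability hE) = 0 →
      ∃ (T : Finset α) (B : Graph α β), T.Nonempty ∧ G.induce (T : Set α) ≤ B ∧ G.IsBlock B ∧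
        T.card ≤ B.vertexSet.ncard ∧ B.vertexSet.ncard ≤ s ∧
        ∀ t ∈ T, Graph.Spans (Graph.LinkedTo G hE.toFinset) t T ∧ Graph.relSum hE z t T = 0 := by
    intro z hz
    obtain ⟨r, hr⟩ := hconn.1
    have hr' : r ∈ hV.toFinset := by simpa using hr
    have hVS : (hV.toFinset : Set α) = G.vertexSet := hV.coe_toFinset
    rw [Graph.aeval_reliability hE hVS hr'] at hz
    have hsp : Graph.Spans (Graph.LinkedTo G hE.toFinset) r hV.toFinset := by
      rw [← Graph.restrict_connected_iff hVS hr', hE.coe_toFinset, Graph.restrict_self]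
      exact hconn
    obtain ⟨T, hT, ⟨t, ht⟩, hall, hcut⟩ :=
      Graph.exists_relSum_eq_zero_of_no_cutVertex hE hr' hsp hz
    have hTV : (T : Set α) ⊆ G.vertexSet := hVS ▸ Finset.coe_subset.2 hT
    obtain ⟨B, hTB, hB⟩ := Graph.exists_isBlock_ge hV hE (Graph.induce_le hTV)
      (Graph.induce_connected hE ht (hall t ht).1) hcut
    refine ⟨T, B, ⟨t, ht⟩, hTB, hB, ?_, hs.2 ⟨B, hB, rfl⟩, hall⟩
    rw [← Set.ncard_coe_finset]
    exact Set.ncard_le_ncard hTB.vertexSet_mono (hV.subset hB.1.1.vertexSet_mono)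
  have second : 3 ≤ s →
      (∀ B : Graph α β, G.IsBlock B → B.vertexSet.ncard = s →
        ∃ w ∈ B.vertexSet, B.NoMultipleEdgesAt w) →
      ∀ z : ℂ, Polynomial.aeval z (G.reliability hE) = 0 → ‖z‖ ≤ (s : ℝ) - 2 := by
    intro h3 hw z hz
    obtain ⟨T, B, ⟨t, ht⟩, hTB, hB, hcard, hBs, hall⟩ := key z hz
    -- If `|T| < s`, the general bound `|T| - 1` is already at most `s - 2`. Otherwise `T` is the
    -- whole vertex set of a largest block, and its vertex `w` serves as root.
    rcases (hcard.trans hBs).lt_or_eq with hlt | heq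
    · have h1 := Graph.norm_le_card_sub_one hE ht (hall t ht).1 (hall t ht).2
      have h2 : (T.card : ℝ) + 1 ≤ s := by exact_mod_cast hlt
      linarith
    · have hTB' : (T : Set α) = B.vertexSet :=
        Set.eq_of_subset_of_ncard_le hTB.vertexSet_mono
          (by rw [Set.ncard_coe_finset]; omega) (hV.subset hB.1.1.vertexSet_mono)
      obtain ⟨w, hwB, hwm⟩ := hw B hB (by omega)
      have hwT : w ∈ T := by rwa [← hTB'] at hwB
      rw [← heq]
      refine Graph.norm_le_card_sub_two hE hwT (hall w hwT).1 (by omega) (fun v hv => ?_)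
        (hall w hwT).2
      refine Finset.card_le_one.2 fun e he f hf => ?_
      simp only [Graph.mem_edgesTo, Finset.mem_singleton, exists_eq_left] at he hf
      -- `B` contains the subgraph induced on `T`, so parallel edges of `G` at `w` within `T` would
      -- be parallel in `B`.
      have hB' : ∀ e, G.IsLink e v w → B.IsLink e w v := fun e he =>
        Graph.IsLink.mono hTB ⟨he.symm, hwT, hv⟩
      exact hwm e f v (hB' e he) (hB' f hf)
  refine ⟨fun z hz => ?_, second, fun h3 hsimple => second h3 fun B hB _ => ?_⟩
  · obtain ⟨T, B, ⟨t, ht⟩, -, -, hcard, hBs, hall⟩ := key z hz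
    have h1 := Graph.norm_le_card_sub_one hE ht (hall t ht).1 (hall t ht).2
    have h2 : (T.card : ℝ) ≤ s := by exact_mod_cast hcard.trans hBs
    linarith
  · obtain ⟨w, hw⟩ := hB.1.2.1.1
    exact ⟨w, hw, fun e f x he hf => (he.mono hB.1.1).eq (hf.mono hB.1.1)⟩
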